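/- Let $G$ be an amenable locally compact Hausdorff topological group; amenable means that there is a positive linear functional $\mathrm m$ with $\mathrm m(1)=1$, invariant under the left translations $f\mapsto f(g^{-1}\,\cdot\,)$, $g\in G$, on the space of bounded right uniformly continuous functions $f:G\to\mathbb R$ (those bounded $f$ such that for every $\varepsilon>0$ there is a neighbourhood $V$ of the identity with $|f(x)-f(y)|<\varepsilon$ whenever $xy^{-1}\in V$). Let $X$ be a Hausdorff locally convex space over $\mathbb R$ or $\mathbb C$, and let $C\subseteq X$ be a nonempty bounded convex subset (not assumed closed or complete). Then $G$ has the weak approximate fixed point property on $C$: for every continuous action $G\times C\to C$ of $G$ on $C$ by affine maps there is a net $(y_j)$ in $C$ such that, for every $g\in G$, $g y_j-y_j\to 0$ in the weak topology $\sigma(X,X')$. -/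

import Mathlib

open Topology Filter
open scoped BoundedContinuousFunction

universe u v w

section Amenability

variable (G : Type u) [Group G] [TopologicalSpace G]

/-- A real function is right uniformly continuous if for every `ε > 0` there is a neighbourhood
`V` of the identity such that `x y⁻¹ ∈ V` implies `|f x - f y| < ε`. -/
def IsRightUniformlyContinuous {G : Type u} [Group G] [TopologicalSpace G] (f : G → ℝ) : Prop :=
  ∀ ε : ℝ, 0 < ε → ∃ V ∈ 𝓝 (1 : G), ∀ x y : G, x * y⁻¹ ∈ V → |f x - f y| < ε

/-- The space of bounded right uniformly continuous real functions on `G`, as a subspace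
of the space of bounded continuous functions with the uniform norm. -/
def RUCB : Submodule ℝ (G →ᵇ ℝ) where
  carrier := {f | IsRightUniformlyContinuous f}
  zero_mem' := by
    intro ε hε
    exact ⟨Set.univ, Filter.univ_mem, fun x y _ => by simpa using hε⟩
  add_mem' := by
    intro f g hf hg ε hε
    obtain ⟨V, hV, hfV⟩ := hf (ε / 2) (by positivity)
    obtain ⟨W, hW, hgW⟩ := hg (ε / 2) (by positivity)
    refine ⟨V ∩ W, Filter.inter_mem hV hW, fun x y hxy => ?_⟩
    have h1 := abs_lt.1 (hfV x y hxy.1)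
    have h2 := abs_lt.1 (hgW x y hxy.2)
    simp only [BoundedContinuousFunction.coe_add, Pi.add_apply]
    rw [abs_lt]
    constructor <;> linarith [h1.1, h1.2, h2.1, h2.2]
  smul_mem' := by
    intro c f hf ε hε
    obtain ⟨V, hV, hfV⟩ := hf (ε / (|c| + 1)) (by positivity)
    refine ⟨V, hV, fun x y hxy => ?_⟩
    have h1 := hfV x y hxy
    rw [lt_div_iff₀ (by positivity)] at h1
    simp only [BoundedContinuousFunction.coe_smul, smul_eq_mul]
    rw [← mul_sub, abs_mul]
    nlinarith [abs_nonneg (f x - f y), abs_nonneg c]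

variable {G}

theorem one_mem_RUCB : (1 : G →ᵇ ℝ) ∈ RUCB G := by
  intro ε hε
  exact ⟨Set.univ, Filter.univ_mem, fun x y _ => by simpa using hε⟩

/-- The left translate `x ↦ f (g⁻¹ x)` of a bounded right uniformly continuous function. -/
def RUCB.leftTranslate [IsTopologicalGroup G] (g : G) (f : RUCB G) : RUCB G :=
  ⟨(f : G →ᵇ ℝ).compContinuous ⟨fun x => g⁻¹ * x, continuous_const_mul g⁻¹⟩, by
    intro ε hε
    obtain ⟨V, hV, hfV⟩ := f.2 ε hε
    have hc : Tendsto (fun x : G => g⁻¹ * x * g) (𝓝 1) (𝓝 1) := by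
      have h : Continuous (fun x : G => g⁻¹ * x * g) := by fun_prop
      simpa using h.tendsto 1
    refine ⟨_, hc hV, fun x y hxy => hfV (g⁻¹ * x) (g⁻¹ * y) ?_⟩
    have h : g⁻¹ * x * (g⁻¹ * y)⁻¹ = g⁻¹ * (x * y⁻¹) * g := by group
    rw [h]
    exact hxy⟩

variable (G)

/-- A topological group is amenable if it admits a left-invariant mean on `RUCB G`, that is, a
positive linear functional `m` with `m 1 = 1`, invariant under all left translations. -/
def IsAmenableGroup [IsTopologicalGroup G] : Prop :=
  ∃ m : RUCB G →ₗ[ℝ] ℝ,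
    (∀ f : RUCB G, (∀ x : G, 0 ≤ (f : G →ᵇ ℝ) x) → 0 ≤ m f) ∧
    m ⟨1, one_mem_RUCB⟩ = 1 ∧
    ∀ (g : G) (f : RUCB G), m (RUCB.leftTranslate g f) = m f

end Amenability

section FixedPoints

/-- An action of `G` on a subset `C` of a real vector space is affine if every `g` preserves the
convex combinations of points of `C` (that lie in `C`). -/
def IsAffineActionOn (G : Type u) [Group G] {X : Type v} [AddCommGroup X] [Module ℝ X]
    (C : Set X) [MulAction G C] : Prop :=
  ∀ (g : G) (x y z : C) (a b : ℝ), 0 ≤ a → 0 ≤ b → a + b = 1 →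
    (z : X) = a • (x : X) + b • (y : X) →
    ((g • z : C) : X) = a • ((g • x : C) : X) + b • ((g • y : C) : X)

/-- The weak approximate fixed point property of `G` on `C ⊆ X`: every (jointly) continuous
affine action of `G` on `C` admits a net `(y j)` in `C` such that `g y j - y j` converges to `0`
in the weak topology `σ(X, X')`, for every `g`. -/
def HasWeakAFPOn (𝕜 : Type w) [RCLike 𝕜] (G : Type u) [Group G] [TopologicalSpace G]
    {X : Type v} [AddCommGroup X] [Module ℝ X] [Module 𝕜 X] [TopologicalSpace X]
    [IsTopologicalAddGroup X] [ContinuousSMul 𝕜 X] (C : Set X) : Prop :=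
  ∀ [MulAction G C] [ContinuousSMul G C], IsAffineActionOn G C →
    ∃ (J : Type (max u v)) (_ : Preorder J) (_ : IsDirectedOrder J) (_ : Nonempty J)
      (y : J → C), ∀ g : G,
        Tendsto (fun j => toWeakSpace 𝕜 X (((g • y j : C) : X) - (y j : X))) atTop (𝓝 0)

end FixedPoints

/-! An orbit function `h ↦ φ (h • x₀)` is bounded and continuous, but without compactness of `C` it
need not be right uniformly continuous, so the given mean `m` is first extended. For `ψ` with
integral 1 take `u ↦ m (ψ * u)`: the convolution is right uniformly continuous, and `m (ψ * u)`
depends on `ψ` only through `∫ ψ`, by uniqueness of Haar measure. This gives invariance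
(`IsAmenableGroup.exists_mean_boundedContinuousFunction`).

For finitely many pairs `(φ i, g i)`, the vectors `(φ i (g i • y - y))` form a convex set in a
finite-dimensional space. If 0 were outside its closure, a separating functional along an orbit
would be bounded below by some `δ > 0`, yet it is a combination of differences between translates
and originals, of mean 0 (`IsAffineActionOn.exists_forall_abs_lt`). -/

section ConvolutionMean

open MeasureTheory
open scoped CompactlySupported Pointwise

/-! ### Convolution with compactly supported functions -/

section

variable {G : Type u} [Group G] [TopologicalSpace G]

theorem RUCB.ext_apply {f g : RUCB G} (h : ∀ x, (f : G →ᵇ ℝ) x = (g : G →ᵇ ℝ) x) : f = g :=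
  Subtype.ext (BoundedContinuousFunction.ext h)

variable [MeasurableSpace G] (μ : Measure G)

/-- The function `x ↦ ∫ ψ h * u (h⁻¹ * x) ∂μ h`. -/
noncomputable def leftConvolution (ψ : C_c(G, ℝ)) (u : G →ᵇ ℝ) (x : G) : ℝ :=
  ∫ h, ψ h * u (h⁻¹ * x) ∂μ

theorem leftConvolution_smul_left (c : ℝ) (ψ : C_c(G, ℝ)) (u : G →ᵇ ℝ)
    (x : G) : leftConvolution μ (c • ψ) u x = c * leftConvolution μ ψ u x := by
  simp only [leftConvolution]
  rw [← integral_const_mul]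
  simp [mul_assoc]

theorem leftConvolution_smul_right (c : ℝ) (ψ : C_c(G, ℝ)) (u : G →ᵇ ℝ)
    (x : G) : leftConvolution μ ψ (c • u) x = c * leftConvolution μ ψ u x := by
  simp only [leftConvolution]
  rw [← integral_const_mul]
  simp [mul_left_comm]

theorem leftConvolution_one (ψ : C_c(G, ℝ)) (x : G) :
    leftConvolution μ ψ 1 x = ∫ h, ψ h ∂μ := by
  simp [leftConvolution]

theorem leftConvolution_nonneg {ψ : C_c(G, ℝ)} (hψ : ∀ h, 0 ≤ ψ h) {u : G →ᵇ ℝ}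
    (hu : ∀ x, 0 ≤ u x) (x : G) : 0 ≤ leftConvolution μ ψ u x :=
  integral_nonneg fun h => mul_nonneg (hψ h) (hu _)

end

variable {G : Type u} [Group G] [TopologicalSpace G] [IsTopologicalGroup G]

theorem IsRightUniformlyContinuous.continuous {f : G → ℝ} (hf : IsRightUniformlyContinuous f) :
    Continuous f := by
  refine continuous_iff_continuousAt.2 fun y => Metric.tendsto_nhds.2 fun ε hε => ?_
  obtain ⟨V, hV, h⟩ := hf ε hε
  have hc : Tendsto (fun x : G => x * y⁻¹) (𝓝 y) (𝓝 1) := by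
    have : Continuous (fun x : G => x * y⁻¹) := by fun_prop
    simpa using this.tendsto y
  filter_upwards [hc hV] with x hx
  exact h x y hx

/-- The precomposition of a compactly supported function with a homeomorphism. -/
def CompactlySupportedContinuousMap.compHomeomorph {Y : Type*} [TopologicalSpace Y]
    (f : C_c(Y, ℝ)) (e : Y ≃ₜ Y) : C_c(Y, ℝ) where
  toFun := fun y => f (e y)
  continuous_toFun := f.continuous.comp e.continuous
  hasCompactSupport' := f.hasCompactSupport.comp_homeomorph e

@[simp]
theorem CompactlySupportedContinuousMap.compHomeomorph_apply {Y : Type*} [TopologicalSpace Y]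
    (f : C_c(Y, ℝ)) (e : Y ≃ₜ Y) (y : Y) : f.compHomeomorph e y = f (e y) := rfl

variable [MeasurableSpace G] [BorelSpace G] (μ : Measure G)

theorem integrable_leftConvolution [IsFiniteMeasureOnCompacts μ] (ψ : C_c(G, ℝ)) (u : G →ᵇ ℝ)
    (x : G) : Integrable (fun h => ψ h * u (h⁻¹ * x)) μ := by
  refine Continuous.integrable_of_hasCompactSupport ?_ ?_
  · have := ψ.continuous
    have := u.continuous
    fun_prop
  · exact ψ.hasCompactSupport.mul_right

theorem abs_leftConvolution_le [IsFiniteMeasureOnCompacts μ] (ψ : C_c(G, ℝ)) (u : G →ᵇ ℝ)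
    (x : G) : |leftConvolution μ ψ u x| ≤ ‖u‖ * ∫ h, |ψ h| ∂μ := by
  rw [← integral_const_mul]
  refine (norm_integral_le_integral_norm (f := fun h => ψ h * u (h⁻¹ * x))).trans
    (integral_mono (integrable_leftConvolution μ ψ u x).norm
      (ψ.integrable.abs.const_mul _) fun h => ?_)
  simp only [norm_mul, Real.norm_eq_abs]
  rw [mul_comm]
  exact mul_le_mul_of_nonneg_right (u.norm_coe_le_norm _) (abs_nonneg _)

theorem leftConvolution_mul_left [μ.IsMulLeftInvariant] (ψ : C_c(G, ℝ)) (u : G →ᵇ ℝ) (v x : G) :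
    leftConvolution μ ψ u (v * x) =
      leftConvolution μ (ψ.compHomeomorph (Homeomorph.mulLeft v)) u x := by
  rw [leftConvolution, ← integral_mul_left_eq_self _ v]
  simp [leftConvolution, mul_assoc]

theorem leftConvolution_sub_left [IsFiniteMeasureOnCompacts μ] (ψ φ : C_c(G, ℝ)) (u : G →ᵇ ℝ)
    (x : G) : leftConvolution μ (ψ - φ) u x =
      leftConvolution μ ψ u x - leftConvolution μ φ u x := by
  simp only [leftConvolution]
  rw [← integral_sub (integrable_leftConvolution μ ψ u x) (integrable_leftConvolution μ φ u x)]
  simp [sub_mul]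

theorem leftConvolution_add_left [IsFiniteMeasureOnCompacts μ] (ψ φ : C_c(G, ℝ)) (u : G →ᵇ ℝ)
    (x : G) : leftConvolution μ (ψ + φ) u x =
      leftConvolution μ ψ u x + leftConvolution μ φ u x := by
  simp only [leftConvolution]
  rw [← integral_add (integrable_leftConvolution μ ψ u x) (integrable_leftConvolution μ φ u x)]
  simp [add_mul]

theorem leftConvolution_add_right [IsFiniteMeasureOnCompacts μ] (ψ : C_c(G, ℝ)) (u t : G →ᵇ ℝ)
    (x : G) : leftConvolution μ ψ (u + t) x =
      leftConvolution μ ψ u x + leftConvolution μ ψ t x := by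
  simp only [leftConvolution]
  rw [← integral_add (integrable_leftConvolution μ ψ u x) (integrable_leftConvolution μ ψ t x)]
  simp [mul_add]

/-- Left translation is continuous in `L¹` on compactly supported functions. -/
theorem tendsto_integral_abs_translate_sub [LocallyCompactSpace G] [IsFiniteMeasureOnCompacts μ]
    (ψ : C_c(G, ℝ)) :
    Tendsto (fun v => ∫ h, |ψ (v * h) - ψ h| ∂μ) (𝓝 1) (𝓝 0) := by
  obtain ⟨W, hW, hW1⟩ := exists_compact_mem_nhds (1 : G)
  have hcont : ContinuousOn (fun v => ∫ h, |ψ (v * h) - ψ h| ∂μ) W := by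
    -- For `v` in the compact `W`, all integrands vanish off one compact set.
    refine continuousOn_integral_of_compact_support
      (k := W⁻¹ * tsupport ψ ∪ tsupport ψ)
      ((hW.inv.mul ψ.hasCompactSupport).union ψ.hasCompactSupport) ?_ ?_
    · have := ψ.continuous
      refine Continuous.continuousOn ?_
      simp only [Function.uncurry_def]
      fun_prop
    · intro v h hv hh
      have h1 : ψ h = 0 := image_eq_zero_of_notMem_tsupport fun hs => hh (Or.inr hs)
      have h2 : ψ (v * h) = 0 := image_eq_zero_of_notMem_tsupport fun hs =>
        hh (Or.inl ⟨v⁻¹, Set.inv_mem_inv.2 hv, v * h, hs, by simp⟩)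
      simp [h1, h2]
  have := (hcont.continuousAt hW1).tendsto
  simpa using this

/-- Moving `x` on the left translates `ψ`, so the variation is at most `‖u‖` times an `L¹` distance,
uniformly in `x`. -/
theorem isRightUniformlyContinuous_leftConvolution [LocallyCompactSpace G]
    [IsFiniteMeasureOnCompacts μ] [μ.IsMulLeftInvariant] (ψ : C_c(G, ℝ)) (u : G →ᵇ ℝ) :
    IsRightUniformlyContinuous (leftConvolution μ ψ u) := by
  intro ε hε
  have h0 := (tendsto_integral_abs_translate_sub μ ψ).const_mul ‖u‖
  rw [mul_zero] at h0
  refine ⟨_, h0 (Iio_mem_nhds hε), fun x y hxy => lt_of_le_of_lt ?_ hxy⟩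
  have hx : x = (x * y⁻¹) * y := by group
  conv_lhs => rw [hx]
  rw [leftConvolution_mul_left, ← leftConvolution_sub_left]
  exact abs_leftConvolution_le μ _ u y

/-! ### Haar uniqueness and extension of the mean -/

variable [μ.IsHaarMeasure]

/-- Substitute `h = k * g`; the pushforward of `μ` under right translation is left invariant, so it
contributes only a modular factor `c`. -/
theorem leftConvolution_comp_mulLeft (g : G) :
    ∃ c : ℝ, ∀ (ψ : C_c(G, ℝ)) (u : G →ᵇ ℝ) (x : G),
      leftConvolution μ ψ (u.compContinuous ⟨fun x => g * x, continuous_const_mul g⟩) x =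
        leftConvolution μ (c • ψ.compHomeomorph (Homeomorph.mulRight g)) u x := by
  refine ⟨(Measure.map (· * g⁻¹) μ).haarScalarFactor μ, fun ψ u x => ?_⟩
  have hψ := ψ.continuous
  have hu := u.continuous
  have hF : Continuous (fun k => ψ (k * g) * u (k⁻¹ * x)) := by fun_prop
  have hFc : HasCompactSupport (fun k => ψ (k * g) * u (k⁻¹ * x)) :=
    (ψ.compHomeomorph (Homeomorph.mulRight g)).hasCompactSupport.mul_right
  have hfin : IsFiniteMeasureOnCompacts (Measure.map (· * g⁻¹) μ) :=
    Measure.IsFiniteMeasureOnCompacts.map μ (Homeomorph.mulRight g⁻¹)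
  have h := Measure.integral_isMulLeftInvariant_eq_smul_of_hasCompactSupport
    (Measure.map (· * g⁻¹) μ) μ hF hFc
  rw [integral_map (by fun_prop) hF.aestronglyMeasurable, integral_smul_nnreal_measure] at h
  rw [leftConvolution_smul_left]
  simpa [leftConvolution, mul_assoc, NNReal.smul_def] using h

variable [LocallyCompactSpace G]

/-- `leftConvolution` as a bounded right uniformly continuous function. -/
noncomputable def RUCB.leftConvolution (ψ : C_c(G, ℝ)) (u : G →ᵇ ℝ) : RUCB G :=
  ⟨BoundedContinuousFunction.ofNormedAddCommGroup (_root_.leftConvolution μ ψ u)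
    (isRightUniformlyContinuous_leftConvolution μ ψ u).continuous _
    (abs_leftConvolution_le μ ψ u),
    isRightUniformlyContinuous_leftConvolution μ ψ u⟩

@[simp]
theorem RUCB.leftConvolution_apply (ψ : C_c(G, ℝ)) (u : G →ᵇ ℝ) (x : G) :
    (RUCB.leftConvolution μ ψ u : G →ᵇ ℝ) x = _root_.leftConvolution μ ψ u x := rfl

theorem RUCB.leftTranslate_leftConvolution (g : G) (ψ : C_c(G, ℝ)) (u : G →ᵇ ℝ) :
    RUCB.leftTranslate g (RUCB.leftConvolution μ ψ u) =
      RUCB.leftConvolution μ (ψ.compHomeomorph (Homeomorph.mulLeft g⁻¹)) u :=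
  RUCB.ext_apply fun x => leftConvolution_mul_left μ ψ u g⁻¹ x

/-- A positive left invariant functional on `RUCB G` evaluated on `ψ * u` depends on `ψ` only
through its integral, when `u` is nonnegative. -/
theorem exists_map_leftConvolution_eq [T2Space G] {m : RUCB G →ₗ[ℝ] ℝ}
    (hpos : ∀ f : RUCB G, (∀ x : G, 0 ≤ (f : G →ᵇ ℝ) x) → 0 ≤ m f)
    (hinv : ∀ (g : G) (f : RUCB G), m (RUCB.leftTranslate g f) = m f)
    {u : G →ᵇ ℝ} (hu : ∀ x, 0 ≤ u x) :
    ∃ c : ℝ, ∀ ψ : C_c(G, ℝ), m (RUCB.leftConvolution μ ψ u) = c * ∫ h, ψ h ∂μ := by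
  let L : C_c(G, ℝ) →ₗ[ℝ] ℝ :=
    { toFun := fun ψ => m (RUCB.leftConvolution μ ψ u)
      map_add' := fun ψ φ => by
        rw [← map_add]
        exact congrArg m (RUCB.ext_apply fun x => leftConvolution_add_left μ ψ φ u x)
      map_smul' := fun c ψ => by
        rw [RingHom.id_apply, ← map_smul]
        exact congrArg m (RUCB.ext_apply fun x => leftConvolution_smul_left μ c ψ u x) }
  let Λ : C_c(G, ℝ) →ₚ[ℝ] ℝ := PositiveLinearMap.mk₀ L fun ψ hψ =>
    hpos _ fun x => leftConvolution_nonneg μ (fun h => hψ h) hu x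
  have hΛ : ∀ ψ, ∫ h, ψ h ∂(RealRMK.rieszMeasure Λ) = m (RUCB.leftConvolution μ ψ u) :=
    fun ψ => RealRMK.integral_rieszMeasure Λ ψ
  -- Translating `ψ` translates `ψ * u`, which `m` does not see.
  have hleft : (RealRMK.rieszMeasure Λ).IsMulLeftInvariant := by
    refine ⟨fun g => ?_⟩
    have : (Measure.map (g * ·) (RealRMK.rieszMeasure Λ)).Regular :=
      Measure.Regular.map (Homeomorph.mulLeft g)
    refine Measure.ext_of_integral_eq_on_compactlySupported fun ψ => ?_
    rw [integral_map (continuous_const_mul g).aemeasurable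
      (map_continuous ψ).aestronglyMeasurable, hΛ ψ]
    have h1 := hΛ (ψ.compHomeomorph (Homeomorph.mulLeft g))
    have h2 := RUCB.leftTranslate_leftConvolution μ g⁻¹ ψ u
    rw [inv_inv] at h2
    rw [← h2, hinv] at h1
    exact h1
  refine ⟨(RealRMK.rieszMeasure Λ).haarScalarFactor μ, fun ψ => ?_⟩
  rw [← hΛ, Measure.integral_isMulLeftInvariant_eq_smul_of_hasCompactSupport _ μ (map_continuous ψ)
    ψ.hasCompactSupport, integral_smul_nnreal_measure]
  rfl

/-- Adding the constant `‖u‖` makes `u` nonnegative and changes `ψ * u` by the constant `‖u‖ * ∫ ψ`.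
-/
theorem map_leftConvolution_congr [T2Space G] {m : RUCB G →ₗ[ℝ] ℝ}
    (hpos : ∀ f : RUCB G, (∀ x : G, 0 ≤ (f : G →ᵇ ℝ) x) → 0 ≤ m f)
    (hinv : ∀ (g : G) (f : RUCB G), m (RUCB.leftTranslate g f) = m f)
    (u : G →ᵇ ℝ) {ψ φ : C_c(G, ℝ)} (h : ∫ x, ψ x ∂μ = ∫ x, φ x ∂μ) :
    m (RUCB.leftConvolution μ ψ u) = m (RUCB.leftConvolution μ φ u) := by
  obtain ⟨c, hc⟩ := exists_map_leftConvolution_eq μ hpos hinv (u := u + ‖u‖ • 1) fun x => by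
    have := (abs_le.1 (u.norm_coe_le_norm x)).1
    simp only [BoundedContinuousFunction.coe_add, BoundedContinuousFunction.coe_smul,
      BoundedContinuousFunction.coe_one, Pi.add_apply, Pi.one_apply, smul_eq_mul, mul_one]
    linarith
  have key : ∀ θ : C_c(G, ℝ), m (RUCB.leftConvolution μ θ u) =
      c * (∫ x, θ x ∂μ) - ‖u‖ * (∫ x, θ x ∂μ) * m ⟨1, one_mem_RUCB⟩ := fun θ => by
    rw [← hc, ← smul_eq_mul (‖u‖ * _), ← map_smul, ← map_sub]
    refine congrArg m (RUCB.ext_apply fun x => ?_)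
    simp [leftConvolution_add_right, leftConvolution_smul_right, leftConvolution_one]
  rw [key, key, h]

/-- A left invariant mean on the bounded right uniformly continuous functions of a locally compact
group yields a left invariant mean on all bounded continuous functions. -/
theorem IsAmenableGroup.exists_mean_boundedContinuousFunction (G : Type u) [Group G]
    [TopologicalSpace G] [IsTopologicalGroup G] [T2Space G] [LocallyCompactSpace G]
    (hG : IsAmenableGroup G) :
    ∃ m : (G →ᵇ ℝ) →ₗ[ℝ] ℝ, (∀ f, (∀ x, 0 ≤ f x) → 0 ≤ m f) ∧ m 1 = 1 ∧
      ∀ (g : G) (f : G →ᵇ ℝ),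
        m (f.compContinuous ⟨fun x => g * x, continuous_const_mul g⟩) = m f := by
  borelize G
  obtain ⟨m, hpos, hone, hinv⟩ := hG
  let μ : Measure G := Measure.haar
  obtain ⟨ψ₁, hψc, hψ0, hψ1⟩ := exists_continuous_nonneg_pos (1 : G)
  let ψ₂ : C_c(G, ℝ) := ⟨ψ₁, hψc⟩
  have hI : 0 < ∫ x, ψ₂ x ∂μ :=
    ψ₁.continuous.integral_pos_of_hasCompactSupport_nonneg_nonzero hψc hψ0 hψ1
  let ψ : C_c(G, ℝ) := (∫ x, ψ₂ x ∂μ)⁻¹ • ψ₂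
  have hψ : ∀ x, 0 ≤ ψ x := fun x => mul_nonneg (inv_nonneg.2 hI.le) (hψ0 x)
  have hψI : ∫ x, ψ x ∂μ = 1 := by
    have : ∫ x, ψ x ∂μ = (∫ x, ψ₂ x ∂μ)⁻¹ * ∫ x, ψ₂ x ∂μ := integral_const_mul _ _
    rw [this, inv_mul_cancel₀ hI.ne']
  refine ⟨
    { toFun := fun u => m (RUCB.leftConvolution μ ψ u)
      map_add' := fun u t => by
        rw [← map_add]
        exact congrArg m (RUCB.ext_apply fun x => leftConvolution_add_right μ ψ u t x)
      map_smul' := fun c u => by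
        rw [RingHom.id_apply, ← map_smul]
        exact congrArg m (RUCB.ext_apply fun x => leftConvolution_smul_right μ c ψ u x) },
    fun f hf => hpos _ fun x => leftConvolution_nonneg μ hψ hf x, ?_, fun g f => ?_⟩
  · rw [← hone]
    exact congrArg m (RUCB.ext_apply fun x => (leftConvolution_one μ ψ x).trans hψI)
  · obtain ⟨c, hc⟩ := leftConvolution_comp_mulLeft μ g
    have h1 : RUCB.leftConvolution μ ψ
        (f.compContinuous ⟨fun x => g * x, continuous_const_mul g⟩) =
        RUCB.leftConvolution μ (c • ψ.compHomeomorph (Homeomorph.mulRight g)) f :=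
      RUCB.ext_apply fun x => hc ψ f x
    -- Testing on `u = 1` shows that both kernels have the same integral, so `c` need not be
    -- computed.
    have h2 := hc ψ 1 1
    rw [leftConvolution_one] at h2
    refine (congrArg m h1).trans (map_leftConvolution_congr μ hpos hinv f ?_)
    rw [← h2]
    exact leftConvolution_one μ ψ 1

end ConvolutionMean

/-! ### Separation argument and the net -/

section WeakApproximateFixedPoints

theorem IsAffineActionOn.convex_range_comp {G : Type u} [Group G] {X : Type v} [AddCommGroup X]
    [Module ℝ X] {C : Set X} (hC : Convex ℝ C) [MulAction G C] (hA : IsAffineActionOn G C)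
    {ι : Type*} (φ : ι → X →ₗ[ℝ] ℝ) (g : ι → G) :
    Convex ℝ (Set.range fun y : C => fun i => φ i (((g i • y : C) : X) - y)) := by
  rintro _ ⟨x, rfl⟩ _ ⟨y, rfl⟩ a b ha hb hab
  refine ⟨⟨a • (x : X) + b • (y : X), hC x.2 y.2 ha hb hab⟩, funext fun i => ?_⟩
  have h := hA (g i) x y ⟨a • (x : X) + b • (y : X), hC x.2 y.2 ha hb hab⟩ a b ha hb hab rfl
  simp only [h, map_sub, map_add, map_smul, Pi.add_apply, Pi.smul_apply, smul_eq_mul]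
  ring

/-- If a group carries a left invariant mean on bounded continuous functions, then a continuous
affine action on a convex set has points moved arbitrarily little by finitely many elements,
measured by finitely many functionals bounded on the set. -/
theorem IsAffineActionOn.exists_forall_abs_lt {G : Type u} [Group G] [TopologicalSpace G]
    [IsTopologicalGroup G] {m : (G →ᵇ ℝ) →ₗ[ℝ] ℝ} (hpos : ∀ f, (∀ x, 0 ≤ f x) → 0 ≤ m f)
    (hone : m 1 = 1)
    (hinv : ∀ (g : G) (f : G →ᵇ ℝ),
      m (f.compContinuous ⟨fun x => g * x, continuous_const_mul g⟩) = m f)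
    {X : Type v} [AddCommGroup X] [Module ℝ X] [TopologicalSpace X] {C : Set X}
    (hne : C.Nonempty) (hC : Convex ℝ C) [MulAction G C] [ContinuousSMul G C]
    (hA : IsAffineActionOn G C) {ι : Type*} [Finite ι] (φ : ι → X →L[ℝ] ℝ)
    (hφ : ∀ i, ∃ M, ∀ x ∈ C, |φ i x| ≤ M) (g : ι → G) {ε : ℝ} (hε : 0 < ε) :
    ∃ y : C, ∀ i, |φ i (((g i • y : C) : X) - y)| < ε := by
  classical
  have := Fintype.ofFinite ι
  obtain ⟨x₀, hx₀⟩ := hne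
  let F : C → ι → ℝ := fun y i => φ i (((g i • y : C) : X) - y)
  have hconv : Convex ℝ (Set.range F) :=
    hA.convex_range_comp hC (fun i => (φ i : X →ₗ[ℝ] ℝ)) g
  have hmem : (0 : ι → ℝ) ∈ closure (Set.range F) := by
    by_contra h0
    obtain ⟨f, δ, hδ, hf⟩ :=
      geometric_hahn_banach_point_closed hconv.closure isClosed_closure h0
    rw [map_zero] at hδ
    choose M hM using hφ
    let U : ι → G →ᵇ ℝ := fun i => BoundedContinuousFunction.ofNormedAddCommGroup
      (fun h : G => φ i ((h • (⟨x₀, hx₀⟩ : C) : C) : X))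
      ((φ i).continuous.comp (continuous_subtype_val.comp (continuous_id.smul continuous_const)))
      (M i) fun h => hM i _ (h • (⟨x₀, hx₀⟩ : C)).2
    -- The separating functional along the orbit of `x₀`, written in coordinates so that invariance
    -- gives `m D = 0`; separation gives `δ ≤ m D`.
    let D : G →ᵇ ℝ := ∑ i, f (Pi.single i 1) •
      ((U i).compContinuous ⟨fun x => g i * x, continuous_const_mul (g i)⟩ - U i)
    have hD : ∀ h : G, D h = f (F (h • ⟨x₀, hx₀⟩)) := fun h => by
      rw [← ContinuousLinearMap.coe_coe, LinearMap.pi_apply_eq_sum_univ]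
      simp only [D, U, F, BoundedContinuousFunction.coe_sum, Finset.sum_apply]
      refine Finset.sum_congr rfl fun i _ => ?_
      have hs : (fun j => if i = j then (1 : ℝ) else 0) = Pi.single i 1 :=
        funext fun j => by simp [Pi.single_apply, eq_comm]
      rw [hs]
      simp [mul_smul, mul_comm]
    have hmD : m D = 0 := by
      simp only [D, map_sum, map_smul, map_sub, hinv, sub_self, smul_zero, Finset.sum_const_zero]
    have hmD' : 0 ≤ m (D - δ • 1) := hpos _ fun h => by
      have := hf _ (subset_closure (Set.mem_range_self (h • (⟨x₀, hx₀⟩ : C))))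
      rw [← hD] at this
      simpa using this.le
    rw [map_sub, map_smul, hmD, hone, smul_eq_mul, mul_one] at hmD'
    linarith
  obtain ⟨_, ⟨y, rfl⟩, hy⟩ := Metric.mem_closure_iff.1 hmem ε hε
  refine ⟨y, fun i => ?_⟩
  have := (dist_le_pi_dist 0 (F y) i).trans_lt hy
  simpa [F, Real.dist_eq, abs_sub_comm] using this

/-- A continuous linear functional is bounded on a von Neumann bounded set. -/
theorem Bornology.IsVonNBounded.exists_forall_norm_le {𝕜 : Type*} [RCLike 𝕜] {X : Type*}
    [AddCommGroup X] [Module 𝕜 X] [TopologicalSpace X] {C : Set X}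
    (hC : Bornology.IsVonNBounded 𝕜 C) (φ : X →L[𝕜] 𝕜) : ∃ M, ∀ x ∈ C, ‖φ x‖ ≤ M := by
  obtain ⟨M, hM⟩ := (NormedSpace.isVonNBounded_iff 𝕜).1 (hC.image φ) |>.exists_norm_le
  exact ⟨M, fun x hx => hM _ ⟨x, hx, rfl⟩⟩

theorem tendsto_toWeakSpace_zero {𝕜 : Type*} [RCLike 𝕜] {X : Type*}
    [AddCommGroup X] [Module 𝕜 X] [TopologicalSpace X] [IsTopologicalAddGroup X]
    [ContinuousSMul 𝕜 X] {J : Type*} {l : Filter J} {z : J → X}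
    (h : ∀ φ : X →L[𝕜] 𝕜, Tendsto (fun j => φ (z j)) l (𝓝 0)) :
    Tendsto (fun j => toWeakSpace 𝕜 X (z j)) l (𝓝 0) := by
  refine (Topology.IsInducing.mk rfl).tendsto_nhds_iff.2 (tendsto_pi_nhds.2 fun φ => ?_)
  have := h φ
  rw [← map_zero φ] at this
  exact this

end WeakApproximateFixedPoints

theorem mainTheorem5
    (G : Type u) [Group G] [TopologicalSpace G] [IsTopologicalGroup G] [T2Space G]
    [LocallyCompactSpace G] (hG : IsAmenableGroup G)
    (𝕜 : Type w) [RCLike 𝕜]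
    (X : Type v) [AddCommGroup X] [Module ℝ X] [Module 𝕜 X] [IsScalarTower ℝ 𝕜 X]
    [TopologicalSpace X] [IsTopologicalAddGroup X] [ContinuousSMul 𝕜 X] [T2Space X]
    [LocallyConvexSpace ℝ X]
    (C : Set X) (hne : C.Nonempty) (hconv : Convex ℝ C) (hbdd : Bornology.IsVonNBounded 𝕜 C) :
    HasWeakAFPOn 𝕜 G C := by
  intro _ _ hA
  obtain ⟨m, hpos, hone, hinv⟩ := hG.exists_mean_boundedContinuousFunction
  classical
  -- `B` contains the real and imaginary parts of every `𝕜`-linear functional, which suffice for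
  -- weak convergence.
  let B := {φ : X →L[ℝ] ℝ // ∃ M, ∀ x ∈ C, |φ x| ≤ M}
  have hex : ∀ j : Finset B × Finset G × ℕ, ∃ y : C, ∀ φ ∈ j.1, ∀ g ∈ j.2.1,
      |φ.1 (((g • y : C) : X) - y)| < 1 / ((j.2.2 : ℝ) + 1) := fun j => by
    obtain ⟨y, hy⟩ := hA.exists_forall_abs_lt hpos hone hinv hne hconv
      (ι := j.1 × j.2.1) (fun i => i.1.1.1) (fun i => i.1.1.2) (fun i => i.2.1)
      (Nat.one_div_pos_of_nat (n := j.2.2))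
    exact ⟨y, fun φ hφ g hg => hy (⟨φ, hφ⟩, ⟨g, hg⟩)⟩
  choose y hy using hex
  have hreal : ∀ (φ : B) (g : G),
      Tendsto (fun j => φ.1 (((g • y j : C) : X) - y j)) atTop (𝓝 0) := fun φ g => by
    refine Metric.tendsto_nhds.2 fun ε hε => ?_
    obtain ⟨n, hn⟩ := exists_nat_one_div_lt hε
    filter_upwards [eventually_ge_atTop (({φ}, {g}, n) : Finset B × Finset G × ℕ)] with j hj
    rw [dist_zero_right, Real.norm_eq_abs]
    refine (hy j φ (hj.1 (by simp)) g (hj.2.1 (by simp))).trans (lt_of_le_of_lt ?_ hn)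
    exact Nat.one_div_le_one_div hj.2.2
  refine ⟨Finset B × Finset G × ℕ, inferInstance, inferInstance, inferInstance, y, fun g => ?_⟩
  refine tendsto_toWeakSpace_zero fun φ => ?_
  obtain ⟨M, hM⟩ := hbdd.exists_forall_norm_le φ
  have hre := hreal ⟨RCLike.reCLM.comp (φ.restrictScalars ℝ), M, fun x hx =>
    (RCLike.abs_re_le_norm _).trans (hM x hx)⟩ g
  have him := hreal ⟨RCLike.imCLM.comp (φ.restrictScalars ℝ), M, fun x hx =>
    (RCLike.abs_im_le_norm _).trans (hM x hx)⟩ g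
  have h := ((RCLike.continuous_ofReal (K := 𝕜)).tendsto 0 |>.comp hre).add
    (((RCLike.continuous_ofReal (K := 𝕜)).tendsto 0 |>.comp him).mul_const RCLike.I)
  simpa [Function.comp_def, RCLike.re_add_im, -map_sub] using h
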